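/- **Model.** Let $k\ge 1$, and let $\theta=(\gamma_0,\gamma_1,\rho,\lambda)$ range over a set $\Theta\subset\mathbb R^{k}\times\mathbb R^k\times(\underline c,\bar c)\times(0,1)$. Two players have covariates $W=(W_1,W_2)$ with values in $\mathbb R^k\times\mathbb R^k$ and take decisions $$D_j=\mathbf 1\{W_j^\top\gamma_0+D_{-j}\,\eta(W_j^\top\gamma_1)\ge\varepsilon_j\},\qquad j=1,2,$$ where $\eta:\mathbb R\to(0,\infty)$ is a known, continuous, strictly increasing function. The errors $(\varepsilon_1,\varepsilon_2)$ are independent of $W$, have known, continuous, strictly increasing marginal CDFs $F_1,F_2$ on $\mathbb R$, and satisfy $\Pr(\varepsilon_1\le a_1,\varepsilon_2\le a_2)=H_\rho(F_1(a_1),F_2(a_2))$ for a known family of copulas $H_\rho$. Put $V_j=F_j(\varepsilon_j)$, $p_j^0=F_j(w_j^\top\gamma_0)$, $p_j^1=F_j(w_j^\top\gamma_0+\eta(w_j^\top\gamma_1))$, $\mathbf p=(p_1^0,p_1^1,p_2^0,p_2^1)$, let $\mathbf P$ be the value of $\mathbf p$ at $w=W$, and write $P_j^d$ for its components. When $P_j^0<V_j\le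 P_j^1$ for both $j$ (multiple equilibria), $D=(0,0)$ is selected if and only if $e\le\lambda$, and $D=(1,1)$ otherwise, where $e$ is uniform on $[0,1]$ and independent of $(W,\varepsilon_1,\varepsilon_2)$. The probability of multiple equilibria is $$\mathcal L_{\rm mul}(\mathbf p;\rho)=H_\rho(p_1^1,p_2^1)-H_\rho(p_1^1,p_2^0)-H_\rho(p_1^0,p_2^1)+H_\rho(p_1^0,p_2^0).$$ **Assumptions on the copulas.** For $\rho\in(\underline c,\bar c)$ the copula $H_\rho$ has a density and is twice differentiable in its arguments on $(0,1)^2$. For all $\rho<\rho'$ in $(\underline c,\bar c)$, $H_{\rho'}$ is strictly more stochastically increasing in joint distribution than $H_\rho$: for every $v\in(0,1)$, $H_\rho(\cdot,v)$ and $H_{\rho'}(\cdot,v)$ are strictly increasing on $[0,1]$, and for every $u\in(0,1)$ the solution $\psi(u,v)\in(0,1)$ of $H_{\rho'}(\psi(u,v),v)=H_\rho(u,v)$ is strictly increasing in $v\in(0,1)$. **Assumptions on the covariates and on $\theta\in\Theta$.** A set $S\subset\mathbb{R}^k$ is said not to lie in a proper linear subspace a.s. if $\Pr(W_1\in S\setminus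 L)>0$ for every proper linear subspace $L\subset\mathbb R^k$. Let $W_{2,1}$ be a fixed coordinate of $W_2$, let $W_{2,-1}$ denote the other coordinates of $W_2$, and let $\gamma_{0,1},\gamma_{1,1}$ be the coefficients of $W_{2,1}$ in $\gamma_0,\gamma_1$. 1. Let $A$ be the set of $(w_1,c)$ such that, conditionally on $(W_1,W_{2,-1})=(w_1,c)$, $W_{2,1}$ has an everywhere positive Lebesgue density on $\mathbb R$. For every proper linear subspace $L$, $\Pr\big((W_1,W_{2,-1})\in A,\ W_1\notin L\big)>0$. 2. The set of $w_1$ for which there are $w_2,\ddot w_2$ with $(w_1,w_2),(w_1,\ddot w_2)\in\operatorname{supp}[W]$ and $w_2^\top\gamma_0\ne\ddot w_2^\top\gamma_0$ is non-empty and does not lie in a proper linear subspace a.s. 3. $\gamma_{0,1}\ne0$, and either $\gamma_{0,1}$ and $\gamma_{1,1}$ have the same (non-zero) sign, or $F_2\big(a+\eta(-c\,a)\big)\to0$ as $a\to-\infty$, where $c=|\gamma_{1,1}/\gamma_{0,1}|$. 4. For every non-zero $w_1\in\operatorname{supp}[W_1]$, the set $\{(w_1^\top\gamma_0'+\eta(w_1^\top\gamma_1'),\rho'):(\gamma_0',\gamma_1',\rho',\lambda')\in\Theta\}\subset\mathbb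 R^2$ is open and simply connected. 5. $\gamma_0\neq0$, $\gamma_1\ne0$, and $\mathcal L_{\rm mul}(\mathbf p;\rho)>0$ for some $\mathbf p\in\operatorname{supp}[\mathbf P]$. **Conclusion.** $\theta$ is globally identified in $\Theta$: if $\theta'\in\Theta$ generates the same joint law of the observables $(W_1,W_2,D_1,D_2)$ as $\theta$, then $\theta'=\theta$. -/

import Mathlib

open MeasureTheory ProbabilityTheory Set Filter Topology

noncomputable section

/-- The parameter `θ = (γ₀, γ₁, ρ, λ)`. -/
structure GameParam (k : ℕ) where
  γ₀ : Fin k → ℝ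
  γ₁ : Fin k → ℝ
  ρ : ℝ
  lam : ℝ

/-- The known ingredients of the model: the interaction function `η`, the marginal CDFs of
`ε₁` and `ε₂`, the copula family `H ρ u₁ u₂`, and the end points of the range of `ρ`. -/
structure GameSpec where
  η : ℝ → ℝ
  F₁ : ℝ → ℝ
  F₂ : ℝ → ℝ
  H : ℝ → ℝ → ℝ → ℝ
  ρmin : ℝ
  ρmax : ℝ

/-- `w_jᵀ γ₀`: the index of a player whose opponent does not take the treatment. -/
def GameParam.index0 {k : ℕ} (θ : GameParam k) (w : Fin k → ℝ) : ℝ :=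
  dotProduct w θ.γ₀

/-- `w_jᵀ γ₀ + η(w_jᵀ γ₁)`: the index of a player whose opponent takes the treatment. -/
def GameSpec.index1 {k : ℕ} (G : GameSpec) (θ : GameParam k) (w : Fin k → ℝ) : ℝ :=
  dotProduct w θ.γ₀ + G.η (dotProduct w θ.γ₁)

/-- The vector `𝐩 = (p₁⁰, p₁¹, p₂⁰, p₂¹)` at the covariate value `w = (w₁, w₂)`. -/
def GameSpec.probVec {k : ℕ} (G : GameSpec) (θ : GameParam k)
    (w : (Fin k → ℝ) × (Fin k → ℝ)) : ℝ × ℝ × ℝ × ℝ :=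
  (G.F₁ (θ.index0 w.1), G.F₁ (G.index1 θ w.1), G.F₂ (θ.index0 w.2), G.F₂ (G.index1 θ w.2))

/-- `𝓛_mul(𝐩; ρ)` for `C = H_ρ`. -/
def multProb (C : ℝ → ℝ → ℝ) (p : ℝ × ℝ × ℝ × ℝ) : ℝ :=
  let (p10, p11, p20, p21) := p
  C p11 p21 - C p11 p20 - C p10 p21 + C p10 p20

/-- The region of `V` in which there are multiple equilibria. -/
def multRegion (p : ℝ × ℝ × ℝ × ℝ) : Set (ℝ × ℝ) :=
  let (p10, p11, p20, p21) := p
  {v | v.1 ∈ Icc 0 1 ∧ v.2 ∈ Icc 0 1 ∧ p10 < v.1 ∧ v.1 ≤ p11 ∧ p20 < v.2 ∧ v.2 ≤ p21}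

/-- The region of `V` in which `D = (0, 0)` is the unique equilibrium. -/
def uniqueRegion00 (p : ℝ × ℝ × ℝ × ℝ) : Set (ℝ × ℝ) :=
  let (p10, _, p20, _) := p
  {v | v.1 ∈ Icc 0 1 ∧ v.2 ∈ Icc 0 1 ∧ p10 < v.1 ∧ p20 < v.2} \ multRegion p

/-- The treatment decision game at the parameter value `θ`, on a probability space `(Ω, P)`:
covariates `W₁, W₂`, treatments `D₁, D₂` (`true` is `1`), unobservables `ε₁, ε₂`, and the
equilibrium selection variable `e`. -/
structure IsTreatmentGame {k : ℕ} (G : GameSpec) (θ : GameParam k)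
    {Ω : Type} [MeasurableSpace Ω] (P : Measure Ω)
    (W₁ W₂ : Ω → Fin k → ℝ) (D₁ D₂ : Ω → Bool) (ε₁ ε₂ e : Ω → ℝ) : Prop where
  isProb : IsProbabilityMeasure P
  meas_W₁ : Measurable W₁
  meas_W₂ : Measurable W₂
  meas_D₁ : Measurable D₁
  meas_D₂ : Measurable D₂
  meas_ε₁ : Measurable ε₁
  meas_ε₂ : Measurable ε₂
  meas_e : Measurable e
  /-- `D₁ = 1{W₁ᵀγ₀ + D₂ η(W₁ᵀγ₁) ≥ ε₁}`. -/
  response₁ : ∀ᵐ ω ∂P, D₁ ω = true ↔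
    dotProduct (W₁ ω) θ.γ₀ + (if D₂ ω = true then 1 else 0) * G.η (dotProduct (W₁ ω) θ.γ₁) ≥ ε₁ ω
  /-- `D₂ = 1{W₂ᵀγ₀ + D₁ η(W₂ᵀγ₁) ≥ ε₂}`. -/
  response₂ : ∀ᵐ ω ∂P, D₂ ω = true ↔
    dotProduct (W₂ ω) θ.γ₀ + (if D₁ ω = true then 1 else 0) * G.η (dotProduct (W₂ ω) θ.γ₁) ≥ ε₂ ω
  /-- `ε` is independent of `W`. -/
  indep_ε : IndepFun (fun ω => (ε₁ ω, ε₂ ω)) (fun ω => (W₁ ω, W₂ ω)) P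
  cdf_ε₁ : ∀ a, P.real {ω | ε₁ ω ≤ a} = G.F₁ a
  cdf_ε₂ : ∀ a, P.real {ω | ε₂ ω ≤ a} = G.F₂ a
  joint_cdf : ∀ a₁ a₂, P.real {ω | ε₁ ω ≤ a₁ ∧ ε₂ ω ≤ a₂} = G.H θ.ρ (G.F₁ a₁) (G.F₂ a₂)
  /-- `e` is uniform on `[0, 1]` and independent of `(W, ε)`. -/
  uniform_e : P.map e = volume.restrict (Icc (0 : ℝ) 1)
  indep_e : IndepFun e (fun ω => (W₁ ω, W₂ ω, ε₁ ω, ε₂ ω)) P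
  /-- `D = (0, 0)` occurs if and only if it is the unique equilibrium, or there are multiple
  equilibria and `e ≤ λ`; here `V_j = F_j(ε_j)`. -/
  selection : ∀ᵐ ω ∂P, (D₁ ω = false ∧ D₂ ω = false) ↔
    ((G.F₁ (ε₁ ω), G.F₂ (ε₂ ω)) ∈ uniqueRegion00 (G.probVec θ (W₁ ω, W₂ ω)) ∨
      ((G.F₁ (ε₁ ω), G.F₂ (ε₂ ω)) ∈ multRegion (G.probVec θ (W₁ ω, W₂ ω)) ∧ e ω ≤ θ.lam))

/-- `Q` is the law of the observables `(W₁, W₂, D₁, D₂)` in the game at the parameter value `θ`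
when the covariates `(W₁, W₂)` have law `μ`. -/
def IsObservableLaw {k : ℕ} (G : GameSpec) (μ : Measure ((Fin k → ℝ) × (Fin k → ℝ)))
    (θ : GameParam k) (Q : Measure (((Fin k → ℝ) × (Fin k → ℝ)) × Bool × Bool)) : Prop :=
  ∃ (Ω : Type) (_ : MeasurableSpace Ω) (P : Measure Ω)
    (W₁ W₂ : Ω → Fin k → ℝ) (D₁ D₂ : Ω → Bool) (ε₁ ε₂ e : Ω → ℝ),
    IsTreatmentGame G θ P W₁ W₂ D₁ D₂ ε₁ ε₂ e ∧
    P.map (fun ω => (W₁ ω, W₂ ω)) = μ ∧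
    P.map (fun ω => ((W₁ ω, W₂ ω), D₁ ω, D₂ ω)) = Q

/-- `θ` is globally identified in `Θ`: no other parameter value in `Θ` generates the same
law of the observables. -/
def IsGloballyIdentified {k : ℕ} (G : GameSpec) (μ : Measure ((Fin k → ℝ) × (Fin k → ℝ)))
    (Θ : Set (GameParam k)) (θ : GameParam k) : Prop :=
  ∀ θ' ∈ Θ, ∀ Q, IsObservableLaw G μ θ Q → IsObservableLaw G μ θ' Q → θ' = θ

/-- `F` is a strictly increasing continuous CDF on `ℝ`. -/
structure IsStrictContinuousCDF (F : ℝ → ℝ) : Prop where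
  strictMono : StrictMono F
  continuous : Continuous F
  tendsto_atBot : Tendsto F atBot (𝓝 0)
  tendsto_atTop : Tendsto F atTop (𝓝 1)

/-- `C` is a bivariate copula (only its values on `[0, 1]²` matter). -/
structure IsCopula (C : ℝ → ℝ → ℝ) : Prop where
  zero_left : ∀ u ∈ Icc (0 : ℝ) 1, C 0 u = 0
  zero_right : ∀ u ∈ Icc (0 : ℝ) 1, C u 0 = 0
  one_left : ∀ u ∈ Icc (0 : ℝ) 1, C 1 u = u
  one_right : ∀ u ∈ Icc (0 : ℝ) 1, C u 1 = u
  two_increasing : ∀ u ∈ Icc (0 : ℝ) 1, ∀ u' ∈ Icc (0 : ℝ) 1, ∀ v ∈ Icc (0 : ℝ) 1,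
    ∀ v' ∈ Icc (0 : ℝ) 1, u ≤ u' → v ≤ v' → 0 ≤ C u' v' - C u' v - C u v' + C u v

/-- `C` has a density on `[0, 1]²`. -/
def HasCopulaDensity (C : ℝ → ℝ → ℝ) : Prop :=
  ∃ h : ℝ × ℝ → ℝ, (∀ z, 0 ≤ h z) ∧ IntegrableOn h (Icc (0 : ℝ) 1 ×ˢ Icc (0 : ℝ) 1) ∧
    ∀ u ∈ Icc (0 : ℝ) 1, ∀ v ∈ Icc (0 : ℝ) 1,
      C u v = ∫ z in Icc (0 : ℝ) u ×ˢ Icc (0 : ℝ) v, h z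

/-- `C` is twice differentiable in its arguments in `(0, 1)²`. -/
def IsTwiceDifferentiable (C : ℝ → ℝ → ℝ) : Prop :=
  ∀ z ∈ Ioo (0 : ℝ) 1 ×ˢ Ioo (0 : ℝ) 1,
    DifferentiableAt ℝ (fun y : ℝ × ℝ => C y.1 y.2) z ∧
    DifferentiableAt ℝ (fderiv ℝ (fun y : ℝ × ℝ => C y.1 y.2)) z

/-- `C'` is strictly more stochastically increasing in joint distribution than `C`: both are
strictly increasing, hence invertible, in the first argument, and
`ψ(u, v) = C'⁻¹(C(u, v) | v)`, the solution of `C'(ψ, v) = C(u, v)`, is strictly increasing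
in `v`. -/
def StrictlyMoreSJ (C C' : ℝ → ℝ → ℝ) : Prop :=
  (∀ v ∈ Ioo (0 : ℝ) 1, StrictMonoOn (fun u => C u v) (Icc 0 1)) ∧
  (∀ v ∈ Ioo (0 : ℝ) 1, StrictMonoOn (fun u => C' u v) (Icc 0 1)) ∧
  ∃ ψ : ℝ → ℝ → ℝ,
    (∀ u ∈ Ioo (0 : ℝ) 1, ∀ v ∈ Ioo (0 : ℝ) 1,
      ψ u v ∈ Ioo (0 : ℝ) 1 ∧ C' (ψ u v) v = C u v) ∧
    ∀ u ∈ Ioo (0 : ℝ) 1, StrictMonoOn (fun v => ψ u v) (Ioo 0 1)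

/-- The covariates on which one conditions for the special regressor `W_{2,i₀}`: all of `w₁`
and the other coordinates of `w₂`. -/
def otherCovariates {k : ℕ} (i₀ : Fin k) (w : (Fin k → ℝ) × (Fin k → ℝ)) :
    (Fin k → ℝ) × ({i : Fin k // i ≠ i₀} → ℝ) :=
  (w.1, fun i => w.2 i)

/-- The set of values of the other covariates given which `W_{2,i₀}` has an everywhere positive
Lebesgue density. -/
def positiveDensitySet {k : ℕ} (i₀ : Fin k) (μ : Measure ((Fin k → ℝ) × (Fin k → ℝ)))
    [IsProbabilityMeasure μ] : Set ((Fin k → ℝ) × ({i : Fin k // i ≠ i₀} → ℝ)) :=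
  {x | ∃ f : ℝ → ENNReal, Measurable f ∧ (∀ t, 0 < f t) ∧
    condDistrib (fun w : (Fin k → ℝ) × (Fin k → ℝ) => w.2 i₀) (otherCovariates i₀) μ x
      = volume.withDensity f}

/-- Large support and rank: the values `w₁` in question do not lie almost surely in a proper
linear subspace of `ℝᵏ`. -/
def LargeSupport {k : ℕ} (i₀ : Fin k) (μ : Measure ((Fin k → ℝ) × (Fin k → ℝ)))
    [IsProbabilityMeasure μ] : Prop :=
  ∀ V : Submodule ℝ (Fin k → ℝ), V ≠ ⊤ →
    μ {w | otherCovariates i₀ w ∈ positiveDensitySet i₀ μ ∧ w.1 ∉ V} ≠ 0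

/-- The set of `w₁` in the conditional support of `W₁` given two values `w₂`, `w₂'` of `W₂` with
different indices `w₂ᵀγ₀ ≠ w₂'ᵀγ₀`. -/
def variationSet {k : ℕ} (γ₀ : Fin k → ℝ) (μ : Measure ((Fin k → ℝ) × (Fin k → ℝ))) :
    Set (Fin k → ℝ) :=
  {w₁ | ∃ w₂ w₂' : Fin k → ℝ, (w₁, w₂) ∈ μ.support ∧ (w₁, w₂') ∈ μ.support ∧
    dotProduct w₂ γ₀ ≠ dotProduct w₂' γ₀}

/-- The set of the previous definition is non-empty and does not lie almost surely in a proper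
linear subspace of `ℝᵏ`. -/
def VariationRank {k : ℕ} (γ₀ : Fin k → ℝ) (μ : Measure ((Fin k → ℝ) × (Fin k → ℝ))) : Prop :=
  (variationSet γ₀ μ).Nonempty ∧
  ∀ V : Submodule ℝ (Fin k → ℝ), V ≠ ⊤ →
    μ.map Prod.fst (variationSet γ₀ μ \ (V : Set (Fin k → ℝ))) ≠ 0

/-- The two coefficients of the special regressor: the one in `γ₀` is non-zero, and either the two
have the same sign, or `F₂(a + η(-c a)) → 0` as `a → -∞` with `c = |γ₁,ᵢ₀ / γ₀,ᵢ₀|`. -/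
def CoefCondition {k : ℕ} (G : GameSpec) (i₀ : Fin k) (θ : GameParam k) : Prop :=
  θ.γ₀ i₀ ≠ 0 ∧
  (0 < θ.γ₀ i₀ * θ.γ₁ i₀ ∨
    Tendsto (fun a : ℝ => G.F₂ (a + G.η (-(|θ.γ₁ i₀ / θ.γ₀ i₀| * a)))) atBot (𝓝 0))

end

/-! The data enter only through three choice probabilities given `w`. Since `η > 0`, the outcomes
(1,0) and (0,1) occur only as unique equilibria, so their probabilities, p₁⁰ − H(p₁⁰, p₂¹) and p₂⁰ −
H(p₁¹, p₂⁰), are free of λ; that of (0,0) is affine in λ with slope 𝓛_mul. Independence of the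
errors and the covariates gives explicit densities for these probabilities, hence equality for
almost every `w` at two equivalent parameters. Copulas are Lipschitz in each argument, so the set of
agreement is closed and contains the support of the covariates.

The parameters are then recovered one at a time.

γ₀ comes from identification at infinity. Fix w₁ and send the second player's index to −∞ through
the special regressor. At θ both p₂⁰ and p₂¹ vanish, so the probability of (1,0) tends to p₁⁰. At θ'
no limit is assumed: it is extracted from the vanishing probabilities of (0,1) and (1,1)
(`eq_of_choiceProb_eq_of_tendsto`). Hence w₁ᵀγ₀ = w₁ᵀγ₀' for some w₁ outside the hyperplane
orthogonal to γ₀' − γ₀, which is absurd unless γ₀' = γ₀.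

ρ comes from variation in p₂⁰. With γ₀ known, (0,1) reveals H_ρ(p₁¹, p₂⁰). If ρ ≠ ρ', two values of
p₂⁰ at one w₁ would give ψ(p₁¹, ·) the same value twice, against its strict monotonicity
(`StrictlyMoreSJ.eq_of_eq_of_eq`).

γ₁ follows by inverting H_ρ(·, p₂⁰), F₁ and η, and using the rank condition again. λ follows from
the probability of (0,0) at a point where 𝓛_mul is positive. -/

/-! ### Copulas and strictly increasing continuous CDFs -/

namespace IsCopula

variable {C : ℝ → ℝ → ℝ}

lemma mono_left (h : IsCopula C) {u u' v : ℝ} (hu : u ∈ Icc (0 : ℝ) 1) (hu' : u' ∈ Icc (0 : ℝ) 1)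
    (hv : v ∈ Icc (0 : ℝ) 1) (huu : u ≤ u') : C u v ≤ C u' v := by
  have := h.two_increasing u hu u' hu' 0 (by simp) v hv huu hv.1
  rw [h.zero_right u hu, h.zero_right u' hu'] at this
  linarith

lemma mono_right (h : IsCopula C) {u v v' : ℝ} (hu : u ∈ Icc (0 : ℝ) 1) (hv : v ∈ Icc (0 : ℝ) 1)
    (hv' : v' ∈ Icc (0 : ℝ) 1) (hvv : v ≤ v') : C u v ≤ C u v' := by
  have := h.two_increasing 0 (by simp) u hu v hv v' hv' hu.1 hvv
  rw [h.zero_left v hv, h.zero_left v' hv'] at this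
  linarith

lemma nonneg (h : IsCopula C) {u v : ℝ} (hu : u ∈ Icc (0 : ℝ) 1) (hv : v ∈ Icc (0 : ℝ) 1) :
    0 ≤ C u v := by
  have := h.mono_right hu (by simp) hv hv.1
  rwa [h.zero_right u hu] at this

lemma le_right (h : IsCopula C) {u v : ℝ} (hu : u ∈ Icc (0 : ℝ) 1) (hv : v ∈ Icc (0 : ℝ) 1) :
    C u v ≤ v := by
  have := h.mono_left hu (by simp) hv hu.2
  rwa [h.one_left v hv] at this

/-- The mass of a strip below height `v` is at most that of the full strip, which is its width
because the margins are uniform. -/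
lemma abs_sub_left_le (h : IsCopula C) {u u' v : ℝ} (hu : u ∈ Icc (0 : ℝ) 1)
    (hu' : u' ∈ Icc (0 : ℝ) 1) (hv : v ∈ Icc (0 : ℝ) 1) : |C u v - C u' v| ≤ |u - u'| := by
  wlog huu : u' ≤ u generalizing u u'
  · rw [abs_sub_comm, abs_sub_comm u]
    exact this hu' hu (le_of_not_ge huu)
  have := h.two_increasing u' hu' u hu v hv 1 (by simp) huu hv.2
  rw [h.one_right u hu, h.one_right u' hu'] at this
  rw [abs_of_nonneg (sub_nonneg.2 (h.mono_left hu' hu hv huu)), abs_of_nonneg (sub_nonneg.2 huu)]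
  linarith

lemma abs_sub_right_le (h : IsCopula C) {u v v' : ℝ} (hu : u ∈ Icc (0 : ℝ) 1)
    (hv : v ∈ Icc (0 : ℝ) 1) (hv' : v' ∈ Icc (0 : ℝ) 1) : |C u v - C u v'| ≤ |v - v'| := by
  wlog hvv : v' ≤ v generalizing v v'
  · rw [abs_sub_comm, abs_sub_comm v]
    exact this hv' hv (le_of_not_ge hvv)
  have := h.two_increasing u hu 1 (by simp) v' hv' v hv hu.2 hvv
  rw [h.one_left v hv, h.one_left v' hv'] at this
  rw [abs_of_nonneg (sub_nonneg.2 (h.mono_right hu hv' hv hvv)), abs_of_nonneg (sub_nonneg.2 hvv)]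
  linarith

lemma continuousOn (h : IsCopula C) :
    ContinuousOn (fun z : ℝ × ℝ => C z.1 z.2) (Icc 0 1 ×ˢ Icc 0 1) := by
  rintro ⟨u, v⟩ ⟨hu, hv⟩
  rw [ContinuousWithinAt, tendsto_iff_dist_tendsto_zero]
  have hlim : Tendsto (fun z : ℝ × ℝ => |z.1 - u| + |z.2 - v|)
      (𝓝[Icc 0 1 ×ˢ Icc 0 1] (u, v)) (𝓝 0) := by
    have : Continuous (fun z : ℝ × ℝ => |z.1 - u| + |z.2 - v|) := by fun_prop
    simpa using (this.tendsto (u, v)).mono_left nhdsWithin_le_nhds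
  refine squeeze_zero' (Eventually.of_forall fun _ => dist_nonneg) ?_ hlim
  filter_upwards [self_mem_nhdsWithin] with z hz
  rw [Real.dist_eq]
  calc |C z.1 z.2 - C u v| ≤ |C z.1 z.2 - C u z.2| + |C u z.2 - C u v| := abs_sub_le _ _ _
    _ ≤ _ := add_le_add (h.abs_sub_left_le hz.1 hu hz.2) (h.abs_sub_right_le hu hz.2 hv)

lemma continuous_comp (h : IsCopula C) {X : Type*} [TopologicalSpace X] {f g : X → ℝ}
    (hf : Continuous f) (hg : Continuous g) (hf' : ∀ x, f x ∈ Icc (0 : ℝ) 1)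
    (hg' : ∀ x, g x ∈ Icc (0 : ℝ) 1) : Continuous fun x => C (f x) (g x) :=
  h.continuousOn.comp_continuous (hf.prodMk hg) fun x => ⟨hf' x, hg' x⟩

end IsCopula

lemma IsStrictContinuousCDF.mem_Ioo {F : ℝ → ℝ} (h : IsStrictContinuousCDF F) (x : ℝ) :
    F x ∈ Ioo (0 : ℝ) 1 := by
  constructor
  · exact (h.strictMono.monotone.le_of_tendsto h.tendsto_atBot (x - 1)).trans_lt
      (h.strictMono (by linarith))
  · exact (h.strictMono (lt_add_one x)).trans_le
      (h.strictMono.monotone.ge_of_tendsto h.tendsto_atTop (x + 1))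

lemma IsStrictContinuousCDF.mem_Icc {F : ℝ → ℝ} (h : IsStrictContinuousCDF F) (x : ℝ) :
    F x ∈ Icc (0 : ℝ) 1 := Ioo_subset_Icc_self (h.mem_Ioo x)

lemma IsStrictContinuousCDF.tendsto_zero_iff {F : ℝ → ℝ} (h : IsStrictContinuousCDF F)
    {α : Type*} {l : Filter α} {f : α → ℝ} :
    Tendsto (fun a => F (f a)) l (𝓝 0) ↔ Tendsto f l atBot := by
  refine ⟨fun hl => Filter.tendsto_atBot.2 fun b => ?_, fun hl => h.tendsto_atBot.comp hl⟩
  filter_upwards [hl.eventually_lt_const (h.mem_Ioo b).1] with a ha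
  exact (h.strictMono.lt_iff_lt.1 ha).le

/-! ### Choice probabilities and the law of the observables -/

/-- The probability of `D = (1, 0)` given `W = w`, where `p = 𝐩(w)`. -/
def choiceProb10 (C : ℝ → ℝ → ℝ) (p : ℝ × ℝ × ℝ × ℝ) : ℝ :=
  p.1 - C p.1 p.2.2.2

/-- The probability of `D = (0, 1)` given `W = w`, where `p = 𝐩(w)`. -/
def choiceProb01 (C : ℝ → ℝ → ℝ) (p : ℝ × ℝ × ℝ × ℝ) : ℝ :=
  p.2.2.1 - C p.2.1 p.2.2.1

/-- The probability of `D = (0, 0)` given `W = w`, where `p = 𝐩(w)`. -/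
def choiceProb00 (C : ℝ → ℝ → ℝ) (lam : ℝ) (p : ℝ × ℝ × ℝ × ℝ) : ℝ :=
  1 - p.1 - p.2.2.1 + C p.1 p.2.2.1 - (1 - lam) * multProb C p

section Laws

variable {Ω X Y A : Type*} [MeasurableSpace Ω] [MeasurableSpace X] [MeasurableSpace Y]
  [MeasurableSpace A] {P : Measure Ω}

/-- Fubini: when `W` and `Z` are independent and `D = d` is the event (W, Z) ∈ S, the measure of the
section of `S` at `w` is a version of the conditional probability of `d`, defined at every `w`. -/
lemma map_prod_singleton_eq_setLIntegral [IsProbabilityMeasure P]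
    [MeasurableSingletonClass A] {W : Ω → X} {Z : Ω → Y} {D : Ω → A}
    (hW : Measurable W) (hZ : Measurable Z) (hD : Measurable D)
    (hmap : P.map (fun ω => (W ω, Z ω)) = (P.map W).prod (P.map Z)) {S : Set (X × Y)}
    (hS : MeasurableSet S) {d : A} (hd : ∀ᵐ ω ∂P, D ω = d ↔ (W ω, Z ω) ∈ S) {B : Set X}
    (hB : MeasurableSet B) :
    P.map (fun ω => (W ω, D ω)) (B ×ˢ {d}) =
      ∫⁻ w in B, P.map Z (Prod.mk w ⁻¹' S) ∂(P.map W) := by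
  have : IsProbabilityMeasure (P.map Z) := Measure.isProbabilityMeasure_map hZ.aemeasurable
  have h1 : P.map (fun ω => (W ω, D ω)) (B ×ˢ {d}) =
      P.map (fun ω => (W ω, Z ω)) (S ∩ Prod.fst ⁻¹' B) := by
    rw [Measure.map_apply (hW.prodMk hD) (hB.prod (measurableSet_singleton d)),
      Measure.map_apply (hW.prodMk hZ) (hS.inter (measurable_fst hB))]
    refine measure_congr ?_
    filter_upwards [hd] with ω hω
    refine propext ?_
    change (W ω ∈ B ∧ D ω = d) ↔ ((W ω, Z ω) ∈ S ∧ W ω ∈ B)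
    rw [hω, and_comm]
  rw [h1, hmap, Measure.prod_apply (hS.inter (measurable_fst hB)), ← lintegral_indicator hB]
  refine lintegral_congr fun w => ?_
  by_cases hw : w ∈ B
  · rw [indicator_of_mem hw]
    congr 1
    ext z
    simp [hw]
  · rw [indicator_of_notMem hw]
    have : Prod.mk w ⁻¹' (S ∩ Prod.fst ⁻¹' B) = ∅ := by
      ext z
      simp [hw]
    rw [this, measure_empty]

/-- The rectangle is a vertical strip cut at height `b₂` minus the same strip cut at height `a₂`. -/
lemma measureReal_rectangle [IsFiniteMeasure P] {f g : Ω → ℝ} (hf : Measurable f)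
    (hg : Measurable g) {J : ℝ → ℝ → ℝ} (hJ : ∀ a b, P.real {ω | f ω ≤ a ∧ g ω ≤ b} = J a b)
    {a₁ b₁ a₂ b₂ : ℝ} (h₁ : a₁ ≤ b₁) (h₂ : a₂ ≤ b₂) :
    P.real {ω | (a₁ < f ω ∧ f ω ≤ b₁) ∧ a₂ < g ω ∧ g ω ≤ b₂} =
      J b₁ b₂ - J b₁ a₂ - J a₁ b₂ + J a₁ a₂ := by
  have hm : ∀ a b, MeasurableSet {ω | f ω ≤ a ∧ g ω ≤ b} := fun a b =>
    (measurableSet_le hf measurable_const).inter (measurableSet_le hg measurable_const)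
  have hstrip : ∀ b, P.real ({ω | f ω ≤ b₁ ∧ g ω ≤ b} \ {ω | f ω ≤ a₁ ∧ g ω ≤ b}) =
      J b₁ b - J a₁ b := fun b => by
    have hsub : {ω | f ω ≤ a₁ ∧ g ω ≤ b} ⊆ {ω | f ω ≤ b₁ ∧ g ω ≤ b} :=
      fun ω hω => ⟨hω.1.trans h₁, hω.2⟩
    rw [measureReal_sdiff hsub (hm _ _), hJ, hJ]
  have : {ω | (a₁ < f ω ∧ f ω ≤ b₁) ∧ a₂ < g ω ∧ g ω ≤ b₂} =
      ({ω | f ω ≤ b₁ ∧ g ω ≤ b₂} \ {ω | f ω ≤ a₁ ∧ g ω ≤ b₂}) \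
        ({ω | f ω ≤ b₁ ∧ g ω ≤ a₂} \ {ω | f ω ≤ a₁ ∧ g ω ≤ a₂}) := by
    ext ω
    simp only [mem_ofPred_eq, Set.mem_sdiff]
    grind
  rw [this, measureReal_sdiff _ ((hm _ _).diff (hm _ _)), hstrip, hstrip]
  · ring
  · intro ω hω
    simp only [mem_ofPred_eq, Set.mem_sdiff] at hω ⊢
    grind

end Laws

namespace IsTreatmentGame

variable {k : ℕ} {G : GameSpec} {θ : GameParam k} {Ω : Type} [MeasurableSpace Ω] {P : Measure Ω}
  {W₁ W₂ : Ω → Fin k → ℝ} {D₁ D₂ : Ω → Bool} {ε₁ ε₂ e : Ω → ℝ}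

lemma map_covariates_unobservables (h : IsTreatmentGame G θ P W₁ W₂ D₁ D₂ ε₁ ε₂ e) :
    P.map (fun ω => ((W₁ ω, W₂ ω), (ε₁ ω, ε₂ ω), e ω)) =
      (P.map fun ω => (W₁ ω, W₂ ω)).prod (P.map fun ω => ((ε₁ ω, ε₂ ω), e ω)) := by
  have := h.isProb
  have hW := h.meas_W₁.prodMk h.meas_W₂
  have hε := h.meas_ε₁.prodMk h.meas_ε₂
  have ie : IndepFun (fun ω => ((W₁ ω, W₂ ω), ε₁ ω, ε₂ ω)) e P :=
    (h.indep_e.comp (φ := id) (ψ := fun x : (Fin k → ℝ) × (Fin k → ℝ) × ℝ × ℝ =>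
      ((x.1, x.2.1), x.2.2.1, x.2.2.2)) measurable_id (by fun_prop)).symm
  have iε : IndepFun (fun ω => (ε₁ ω, ε₂ ω)) e P :=
    ie.comp (φ := Prod.snd) (ψ := id) measurable_snd measurable_id
  have hW_prob := Measure.isProbabilityMeasure_map (μ := P) hW.aemeasurable
  have hε_prob := Measure.isProbabilityMeasure_map (μ := P) hε.aemeasurable
  have he_prob := Measure.isProbabilityMeasure_map (μ := P) h.meas_e.aemeasurable
  have e1 := (indepFun_iff_map_prod_eq_prod_map_map (hW.prodMk hε).aemeasurable
    h.meas_e.aemeasurable).1 ie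
  have e2 := (indepFun_iff_map_prod_eq_prod_map_map hW.aemeasurable hε.aemeasurable).1
    h.indep_ε.symm
  have e3 := (indepFun_iff_map_prod_eq_prod_map_map hε.aemeasurable h.meas_e.aemeasurable).1 iε
  rw [e3, ← Measure.prodAssoc_prod, ← e2, ← e1,
    Measure.map_map (by fun_prop) ((hW.prodMk hε).prodMk h.meas_e)]
  rfl

/-- The opponent's treatment only raises the index, so `ε₁ ≤ index0` makes 1 a dominant action for
the first player and `index1 < ε₂` makes 0 dominant for the second. The selection rule plays no
role. -/
lemma ae_choice_iff_10 (h : IsTreatmentGame G θ P W₁ W₂ D₁ D₂ ε₁ ε₂ e) (hη : ∀ x, 0 < G.η x) :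
    ∀ᵐ ω ∂P, (D₁ ω, D₂ ω) = (true, false) ↔
      ε₁ ω ≤ θ.index0 (W₁ ω) ∧ G.index1 θ (W₂ ω) < ε₂ ω := by
  filter_upwards [h.response₁, h.response₂] with ω h₁ h₂
  have := hη (dotProduct (W₁ ω) θ.γ₁)
  have := hη (dotProduct (W₂ ω) θ.γ₁)
  simp only [GameParam.index0, GameSpec.index1, Prod.mk.injEq]
  cases hD₁ : D₁ ω <;> cases hD₂ : D₂ ω <;> simp [hD₁, hD₂] at h₁ h₂ ⊢ <;> grind

lemma ae_choice_iff_01 (h : IsTreatmentGame G θ P W₁ W₂ D₁ D₂ ε₁ ε₂ e) (hη : ∀ x, 0 < G.η x) :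
    ∀ᵐ ω ∂P, (D₁ ω, D₂ ω) = (false, true) ↔
      ε₂ ω ≤ θ.index0 (W₂ ω) ∧ G.index1 θ (W₁ ω) < ε₁ ω := by
  filter_upwards [h.response₁, h.response₂] with ω h₁ h₂
  have := hη (dotProduct (W₁ ω) θ.γ₁)
  have := hη (dotProduct (W₂ ω) θ.γ₁)
  simp only [GameParam.index0, GameSpec.index1, Prod.mk.injEq]
  cases hD₁ : D₁ ω <;> cases hD₂ : D₂ ω <;> simp [hD₁, hD₂] at h₁ h₂ ⊢ <;> grind

lemma ae_choice_iff_00 (h : IsTreatmentGame G θ P W₁ W₂ D₁ D₂ ε₁ ε₂ e)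
    (hF₁ : IsStrictContinuousCDF G.F₁) (hF₂ : IsStrictContinuousCDF G.F₂) :
    ∀ᵐ ω ∂P, (D₁ ω, D₂ ω) = (false, false) ↔
      (θ.index0 (W₁ ω) < ε₁ ω ∧ θ.index0 (W₂ ω) < ε₂ ω) ∧
        (ε₁ ω ≤ G.index1 θ (W₁ ω) → ε₂ ω ≤ G.index1 θ (W₂ ω) → e ω ≤ θ.lam) := by
  filter_upwards [h.selection] with ω hω
  have h₁ := hF₁.mem_Icc (ε₁ ω)
  have h₂ := hF₂.mem_Icc (ε₂ ω)
  rw [Prod.mk.injEq, hω]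
  simp only [uniqueRegion00, multRegion, GameSpec.probVec, Set.mem_sdiff, mem_ofPred_eq, h₁, h₂,
    true_and, hF₁.strictMono.lt_iff_lt, hF₂.strictMono.lt_iff_lt, hF₁.strictMono.le_iff_le,
    hF₂.strictMono.le_iff_le]
  tauto

end IsTreatmentGame

lemma GameParam.measurable_index0 {k : ℕ} (θ : GameParam k) : Measurable θ.index0 := by
  unfold GameParam.index0 dotProduct
  fun_prop

lemma GameParam.continuous_index0 {k : ℕ} (θ : GameParam k) : Continuous θ.index0 := by
  unfold GameParam.index0 dotProduct
  fun_prop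

lemma GameSpec.continuous_index1 {k : ℕ} {G : GameSpec} (hη : Continuous G.η) (θ : GameParam k) :
    Continuous (G.index1 θ) := by
  unfold GameSpec.index1 dotProduct
  fun_prop

namespace IsObservableLaw

variable {k : ℕ} {G : GameSpec} {μ : Measure ((Fin k → ℝ) × (Fin k → ℝ))} {θ : GameParam k}
  {Q : Measure (((Fin k → ℝ) × (Fin k → ℝ)) × Bool × Bool)}

lemma exists_density_10 (h : IsObservableLaw G μ θ Q) (hη : ∀ x, 0 < G.η x)
    (hη_cont : Continuous G.η) :
    ∃ g : (Fin k → ℝ) × (Fin k → ℝ) → ENNReal, Measurable g ∧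
      (∀ B, MeasurableSet B → Q (B ×ˢ {(true, false)}) = ∫⁻ w in B, g w ∂μ) ∧
      ∀ w, (g w).toReal = choiceProb10 (G.H θ.ρ) (G.probVec θ w) := by
  obtain ⟨Ω, _, P, W₁, W₂, D₁, D₂, ε₁, ε₂, e, hg, rfl, rfl⟩ := h
  have := hg.isProb
  have hW := hg.meas_W₁.prodMk hg.meas_W₂
  have hε := hg.meas_ε₁.prodMk hg.meas_ε₂
  have hZ := hε.prodMk hg.meas_e
  have := Measure.isProbabilityMeasure_map (μ := P) hZ.aemeasurable
  have hi1 := (G.continuous_index1 hη_cont θ).measurable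
  have hi0 := θ.measurable_index0
  set S : Set (((Fin k → ℝ) × (Fin k → ℝ)) × (ℝ × ℝ) × ℝ) :=
    {x | x.2.1.1 ≤ θ.index0 x.1.1 ∧ G.index1 θ x.1.2 < x.2.1.2} with hS_def
  have hz₁ : Measurable fun x : ((Fin k → ℝ) × (Fin k → ℝ)) × (ℝ × ℝ) × ℝ => x.2.1.1 := by
    fun_prop
  have hz₂ : Measurable fun x : ((Fin k → ℝ) × (Fin k → ℝ)) × (ℝ × ℝ) × ℝ => x.2.1.2 := by
    fun_prop
  have hx₁ : Measurable fun x : ((Fin k → ℝ) × (Fin k → ℝ)) × (ℝ × ℝ) × ℝ => θ.index0 x.1.1 := by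
    fun_prop
  have hx₂ : Measurable fun x : ((Fin k → ℝ) × (Fin k → ℝ)) × (ℝ × ℝ) × ℝ => G.index1 θ x.1.2 := by
    fun_prop
  have hS : MeasurableSet S := (measurableSet_le hz₁ hx₁).inter (measurableSet_lt hx₂ hz₂)
  refine ⟨fun w => P.map (fun ω => ((ε₁ ω, ε₂ ω), e ω)) (Prod.mk w ⁻¹' S),
    measurable_measure_prodMk_left hS, fun B hB => ?_, fun w => ?_⟩
  · exact map_prod_singleton_eq_setLIntegral hW hZ (hg.meas_D₁.prodMk hg.meas_D₂)
      hg.map_covariates_unobservables hS (hg.ae_choice_iff_10 hη) hB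
  · have hm : MeasurableSet {ω | ε₁ ω ≤ θ.index0 w.1 ∧ ε₂ ω ≤ G.index1 θ w.2} :=
      (measurableSet_le hg.meas_ε₁ measurable_const).inter
        (measurableSet_le hg.meas_ε₂ measurable_const)
    have hsub : {ω | ε₁ ω ≤ θ.index0 w.1 ∧ ε₂ ω ≤ G.index1 θ w.2} ⊆
        {ω | ε₁ ω ≤ θ.index0 w.1} := fun ω hω => hω.1
    have heq : (fun ω => ((ε₁ ω, ε₂ ω), e ω)) ⁻¹' (Prod.mk w ⁻¹' S) =
        {ω | ε₁ ω ≤ θ.index0 w.1} \ {ω | ε₁ ω ≤ θ.index0 w.1 ∧ ε₂ ω ≤ G.index1 θ w.2} := by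
      ext ω
      simp only [hS_def, mem_preimage, mem_ofPred_eq, Set.mem_sdiff]
      grind
    beta_reduce
    rw [Measure.map_apply hZ (measurable_prodMk_left hS), heq, ← measureReal_def,
      measureReal_sdiff hsub hm, hg.cdf_ε₁, hg.joint_cdf]
    rfl

lemma exists_density_01 (h : IsObservableLaw G μ θ Q) (hη : ∀ x, 0 < G.η x)
    (hη_cont : Continuous G.η) :
    ∃ g : (Fin k → ℝ) × (Fin k → ℝ) → ENNReal, Measurable g ∧
      (∀ B, MeasurableSet B → Q (B ×ˢ {(false, true)}) = ∫⁻ w in B, g w ∂μ) ∧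
      ∀ w, (g w).toReal = choiceProb01 (G.H θ.ρ) (G.probVec θ w) := by
  obtain ⟨Ω, _, P, W₁, W₂, D₁, D₂, ε₁, ε₂, e, hg, rfl, rfl⟩ := h
  have := hg.isProb
  have hW := hg.meas_W₁.prodMk hg.meas_W₂
  have hε := hg.meas_ε₁.prodMk hg.meas_ε₂
  have hZ := hε.prodMk hg.meas_e
  have := Measure.isProbabilityMeasure_map (μ := P) hZ.aemeasurable
  have hi1 := (G.continuous_index1 hη_cont θ).measurable
  have hi0 := θ.measurable_index0
  set S : Set (((Fin k → ℝ) × (Fin k → ℝ)) × (ℝ × ℝ) × ℝ) :=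
    {x | x.2.1.2 ≤ θ.index0 x.1.2 ∧ G.index1 θ x.1.1 < x.2.1.1} with hS_def
  have hz₁ : Measurable fun x : ((Fin k → ℝ) × (Fin k → ℝ)) × (ℝ × ℝ) × ℝ => x.2.1.1 := by
    fun_prop
  have hz₂ : Measurable fun x : ((Fin k → ℝ) × (Fin k → ℝ)) × (ℝ × ℝ) × ℝ => x.2.1.2 := by
    fun_prop
  have hx₁ : Measurable fun x : ((Fin k → ℝ) × (Fin k → ℝ)) × (ℝ × ℝ) × ℝ => θ.index0 x.1.2 := by
    fun_prop
  have hx₂ : Measurable fun x : ((Fin k → ℝ) × (Fin k → ℝ)) × (ℝ × ℝ) × ℝ => G.index1 θ x.1.1 := by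
    fun_prop
  have hS : MeasurableSet S := (measurableSet_le hz₂ hx₁).inter (measurableSet_lt hx₂ hz₁)
  refine ⟨fun w => P.map (fun ω => ((ε₁ ω, ε₂ ω), e ω)) (Prod.mk w ⁻¹' S),
    measurable_measure_prodMk_left hS, fun B hB => ?_, fun w => ?_⟩
  · exact map_prod_singleton_eq_setLIntegral hW hZ (hg.meas_D₁.prodMk hg.meas_D₂)
      hg.map_covariates_unobservables hS (hg.ae_choice_iff_01 hη) hB
  · have hm : MeasurableSet {ω | ε₁ ω ≤ G.index1 θ w.1 ∧ ε₂ ω ≤ θ.index0 w.2} :=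
      (measurableSet_le hg.meas_ε₁ measurable_const).inter
        (measurableSet_le hg.meas_ε₂ measurable_const)
    have hsub : {ω | ε₁ ω ≤ G.index1 θ w.1 ∧ ε₂ ω ≤ θ.index0 w.2} ⊆
        {ω | ε₂ ω ≤ θ.index0 w.2} := fun ω hω => hω.2
    have heq : (fun ω => ((ε₁ ω, ε₂ ω), e ω)) ⁻¹' (Prod.mk w ⁻¹' S) =
        {ω | ε₂ ω ≤ θ.index0 w.2} \ {ω | ε₁ ω ≤ G.index1 θ w.1 ∧ ε₂ ω ≤ θ.index0 w.2} := by
      ext ω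
      simp only [hS_def, mem_preimage, mem_ofPred_eq, Set.mem_sdiff]
      grind
    beta_reduce
    rw [Measure.map_apply hZ (measurable_prodMk_left hS), heq, ← measureReal_def,
      measureReal_sdiff hsub hm, hg.cdf_ε₂, hg.joint_cdf]
    rfl

lemma exists_density_00 (h : IsObservableLaw G μ θ Q) (hη : ∀ x, 0 < G.η x)
    (hη_cont : Continuous G.η) (hF₁ : IsStrictContinuousCDF G.F₁)
    (hF₂ : IsStrictContinuousCDF G.F₂) (hlam : θ.lam ∈ Ioo (0 : ℝ) 1) :
    ∃ g : (Fin k → ℝ) × (Fin k → ℝ) → ENNReal, Measurable g ∧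
      (∀ B, MeasurableSet B → Q (B ×ˢ {(false, false)}) = ∫⁻ w in B, g w ∂μ) ∧
      ∀ w, (g w).toReal = choiceProb00 (G.H θ.ρ) θ.lam (G.probVec θ w) := by
  obtain ⟨Ω, _, P, W₁, W₂, D₁, D₂, ε₁, ε₂, e, hg, rfl, rfl⟩ := h
  have := hg.isProb
  have hW := hg.meas_W₁.prodMk hg.meas_W₂
  have hε := hg.meas_ε₁.prodMk hg.meas_ε₂
  have hZ := hε.prodMk hg.meas_e
  have := Measure.isProbabilityMeasure_map (μ := P) hZ.aemeasurable
  have hi1 := (G.continuous_index1 hη_cont θ).measurable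
  have hi0 := θ.measurable_index0
  set S : Set (((Fin k → ℝ) × (Fin k → ℝ)) × (ℝ × ℝ) × ℝ) :=
    {x | (θ.index0 x.1.1 < x.2.1.1 ∧ θ.index0 x.1.2 < x.2.1.2) ∧
      (x.2.1.1 ≤ G.index1 θ x.1.1 → x.2.1.2 ≤ G.index1 θ x.1.2 → x.2.2 ≤ θ.lam)} with hS_def
  have hz₁ : Measurable fun x : ((Fin k → ℝ) × (Fin k → ℝ)) × (ℝ × ℝ) × ℝ => x.2.1.1 := by
    fun_prop
  have hz₂ : Measurable fun x : ((Fin k → ℝ) × (Fin k → ℝ)) × (ℝ × ℝ) × ℝ => x.2.1.2 := by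
    fun_prop
  have hz₃ : Measurable fun x : ((Fin k → ℝ) × (Fin k → ℝ)) × (ℝ × ℝ) × ℝ => x.2.2 := by
    fun_prop
  have hx₁ : Measurable fun x : ((Fin k → ℝ) × (Fin k → ℝ)) × (ℝ × ℝ) × ℝ => θ.index0 x.1.1 := by
    fun_prop
  have hx₂ : Measurable fun x : ((Fin k → ℝ) × (Fin k → ℝ)) × (ℝ × ℝ) × ℝ => θ.index0 x.1.2 := by
    fun_prop
  have hy₁ : Measurable fun x : ((Fin k → ℝ) × (Fin k → ℝ)) × (ℝ × ℝ) × ℝ => G.index1 θ x.1.1 := by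
    fun_prop
  have hy₂ : Measurable fun x : ((Fin k → ℝ) × (Fin k → ℝ)) × (ℝ × ℝ) × ℝ => G.index1 θ x.1.2 := by
    fun_prop
  have hS : MeasurableSet S :=
    ((measurableSet_lt hx₁ hz₁).inter (measurableSet_lt hx₂ hz₂)).inter
      ((measurableSet_le hz₁ hy₁).imp
        ((measurableSet_le hz₂ hy₂).imp (measurableSet_le hz₃ measurable_const)))
  refine ⟨fun w => P.map (fun ω => ((ε₁ ω, ε₂ ω), e ω)) (Prod.mk w ⁻¹' S),
    measurable_measure_prodMk_left hS, fun B hB => ?_, fun w => ?_⟩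
  · exact map_prod_singleton_eq_setLIntegral hW hZ (hg.meas_D₁.prodMk hg.meas_D₂)
      hg.map_covariates_unobservables hS (hg.ae_choice_iff_00 hF₁ hF₂) hB
  · set a₁ := θ.index0 w.1
    set a₂ := θ.index0 w.2
    set b₁ := G.index1 θ w.1
    set b₂ := G.index1 θ w.2
    have hab₁ : a₁ ≤ b₁ := le_add_of_nonneg_right (hη _).le
    have hab₂ : a₂ ≤ b₂ := le_add_of_nonneg_right (hη _).le
    set R : Set (ℝ × ℝ) := {z | (a₁ < z.1 ∧ z.1 ≤ b₁) ∧ a₂ < z.2 ∧ z.2 ≤ b₂} with hR_def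
    have hR : MeasurableSet R :=
      ((measurableSet_lt measurable_const measurable_fst).inter
        (measurableSet_le measurable_fst measurable_const)).inter
      ((measurableSet_lt measurable_const measurable_snd).inter
        (measurableSet_le measurable_snd measurable_const))
    have hm₁ : MeasurableSet {ω | ε₁ ω ≤ a₁} := measurableSet_le hg.meas_ε₁ measurable_const
    have hm₂ : MeasurableSet {ω | ε₂ ω ≤ a₂} := measurableSet_le hg.meas_ε₂ measurable_const
    have hRmult : P.real ((fun ω => (ε₁ ω, ε₂ ω)) ⁻¹' R) =
        multProb (G.H θ.ρ) (G.probVec θ w) :=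
      measureReal_rectangle hg.meas_ε₁ hg.meas_ε₂ hg.joint_cdf hab₁ hab₂
    have he : P.real (e ⁻¹' Ioi θ.lam) = 1 - θ.lam := by
      rw [measureReal_def, ← Measure.map_apply hg.meas_e measurableSet_Ioi, hg.uniform_e,
        Measure.restrict_apply measurableSet_Ioi]
      have : Ioi θ.lam ∩ Icc 0 1 = Ioc θ.lam 1 := by
        ext x
        have := hlam.1
        simp only [mem_inter_iff, mem_Ioi, mem_Icc, mem_Ioc]
        grind
      rw [this, Real.volume_Ioc, ENNReal.toReal_ofReal (by linarith [hlam.2])]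
    have hind : IndepFun (fun ω => (ε₁ ω, ε₂ ω)) e P :=
      (hg.indep_e.comp (φ := id) (ψ := fun x : (Fin k → ℝ) × (Fin k → ℝ) × ℝ × ℝ => x.2.2)
        measurable_id (by fun_prop)).symm
    have hmult : P.real ((fun ω => (ε₁ ω, ε₂ ω)) ⁻¹' R ∩ e ⁻¹' Ioi θ.lam) =
        multProb (G.H θ.ρ) (G.probVec θ w) * (1 - θ.lam) := by
      rw [measureReal_def, hind.measure_inter_preimage_eq_mul _ _ hR measurableSet_Ioi,
        ENNReal.toReal_mul, ← measureReal_def, ← measureReal_def, hRmult, he]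
    have hquad : P.real ({ω | ε₁ ω ≤ a₁} ∪ {ω | ε₂ ω ≤ a₂})ᶜ =
        1 - G.F₁ a₁ - G.F₂ a₂ + G.H θ.ρ (G.F₁ a₁) (G.F₂ a₂) := by
      have hunion := measureReal_union_add_inter (μ := P) (s := {ω | ε₁ ω ≤ a₁}) hm₂
      have hinter : P.real ({ω | ε₁ ω ≤ a₁} ∩ {ω | ε₂ ω ≤ a₂}) = _ := hg.joint_cdf a₁ a₂
      rw [hinter, hg.cdf_ε₁, hg.cdf_ε₂] at hunion
      rw [probReal_compl_eq_one_sub (hm₁.union hm₂)]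
      linarith
    -- The upper quadrant, where (0,0) is an equilibrium, loses exactly the part of the multiplicity
    -- rectangle that is assigned to (1,1).
    have heq : (fun ω => ((ε₁ ω, ε₂ ω), e ω)) ⁻¹' (Prod.mk w ⁻¹' S) =
        ({ω | ε₁ ω ≤ a₁} ∪ {ω | ε₂ ω ≤ a₂})ᶜ \
          ((fun ω => (ε₁ ω, ε₂ ω)) ⁻¹' R ∩ e ⁻¹' Ioi θ.lam) := by
      ext ω
      simp only [hS_def, hR_def, mem_preimage, mem_ofPred_eq, Set.mem_sdiff, mem_compl_iff, mem_union,
        mem_inter_iff, mem_Ioi]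
      grind
    have hsub : (fun ω => (ε₁ ω, ε₂ ω)) ⁻¹' R ∩ e ⁻¹' Ioi θ.lam ⊆
        ({ω | ε₁ ω ≤ a₁} ∪ {ω | ε₂ ω ≤ a₂})ᶜ := by
      intro ω
      simp only [hR_def, mem_preimage, mem_ofPred_eq, mem_compl_iff, mem_union,
        mem_inter_iff, mem_Ioi]
      grind
    beta_reduce
    rw [Measure.map_apply hZ (measurable_prodMk_left hS), heq, ← measureReal_def,
      measureReal_sdiff hsub ((hε hR).inter (hg.meas_e measurableSet_Ioi)), hquad, hmult,
      choiceProb00, mul_comm]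
    rfl

end IsObservableLaw

lemma ae_eq_of_setLIntegral_eq_of_toReal {X A : Type*} [MeasurableSpace X] [MeasurableSpace A]
    {μ : Measure X} [SigmaFinite μ] {Q : Measure (X × A)} {d : A} {q q' : X → ℝ}
    (h : ∃ g : X → ENNReal, Measurable g ∧
      (∀ B, MeasurableSet B → Q (B ×ˢ {d}) = ∫⁻ w in B, g w ∂μ) ∧ ∀ w, (g w).toReal = q w)
    (h' : ∃ g : X → ENNReal, Measurable g ∧
      (∀ B, MeasurableSet B → Q (B ×ˢ {d}) = ∫⁻ w in B, g w ∂μ) ∧ ∀ w, (g w).toReal = q' w) :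
    ∀ᵐ w ∂μ, q w = q' w := by
  obtain ⟨g, hg, hgQ, hgq⟩ := h
  obtain ⟨g', hg', hgQ', hgq'⟩ := h'
  have : g =ᵐ[μ] g' := ae_eq_of_forall_setLIntegral_eq_of_sigmaFinite hg hg' fun B hB _ => by
    rw [← hgQ B hB, hgQ' B hB]
  filter_upwards [this] with w hw
  rw [← hgq, ← hgq', hw]

/-! ### Observational equivalence on the support of the covariates -/

/-- The choice probabilities at `θ` and `θ'` agree at the covariate value `w`. -/
def GameSpec.ChoiceProbsAgree {k : ℕ} (G : GameSpec) (θ θ' : GameParam k)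
    (w : (Fin k → ℝ) × (Fin k → ℝ)) : Prop :=
  choiceProb10 (G.H θ.ρ) (G.probVec θ w) = choiceProb10 (G.H θ'.ρ) (G.probVec θ' w) ∧
  choiceProb01 (G.H θ.ρ) (G.probVec θ w) = choiceProb01 (G.H θ'.ρ) (G.probVec θ' w) ∧
  choiceProb00 (G.H θ.ρ) θ.lam (G.probVec θ w) = choiceProb00 (G.H θ'.ρ) θ'.lam (G.probVec θ' w)

namespace GameSpec

variable {k : ℕ} {G : GameSpec}

lemma probVec_mem (hF₁ : IsStrictContinuousCDF G.F₁) (hF₂ : IsStrictContinuousCDF G.F₂)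
    (θ : GameParam k) (w : (Fin k → ℝ) × (Fin k → ℝ)) :
    (G.probVec θ w).1 ∈ Icc (0 : ℝ) 1 ∧ (G.probVec θ w).2.1 ∈ Icc (0 : ℝ) 1 ∧
      (G.probVec θ w).2.2.1 ∈ Icc (0 : ℝ) 1 ∧ (G.probVec θ w).2.2.2 ∈ Icc (0 : ℝ) 1 :=
  ⟨hF₁.mem_Icc _, hF₁.mem_Icc _, hF₂.mem_Icc _, hF₂.mem_Icc _⟩

lemma continuous_probVec (hη : Continuous G.η) (hF₁ : Continuous G.F₁) (hF₂ : Continuous G.F₂)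
    (θ : GameParam k) : Continuous (G.probVec θ) := by
  have h0 := θ.continuous_index0
  have h1 := G.continuous_index1 hη θ
  unfold probVec
  fun_prop

/-- Closedness turns almost sure agreement into agreement at every support point and along every
line of the special regressor. -/
lemma isClosed_choiceProbsAgree (hη : Continuous G.η) (hF₁ : IsStrictContinuousCDF G.F₁)
    (hF₂ : IsStrictContinuousCDF G.F₂) {θ θ' : GameParam k} (hC : IsCopula (G.H θ.ρ))
    (hC' : IsCopula (G.H θ'.ρ)) : IsClosed {w | G.ChoiceProbsAgree θ θ' w} := by
  have key : ∀ {θ : GameParam k}, IsCopula (G.H θ.ρ) →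
      Continuous (fun w => choiceProb10 (G.H θ.ρ) (G.probVec θ w)) ∧
      Continuous (fun w => choiceProb01 (G.H θ.ρ) (G.probVec θ w)) ∧
      Continuous (fun w => choiceProb00 (G.H θ.ρ) θ.lam (G.probVec θ w)) := by
    intro θ hC
    have hp := continuous_probVec hη hF₁.continuous hF₂.continuous θ
    have hm := probVec_mem hF₁ hF₂ θ
    have h00 := hC.continuous_comp hp.fst hp.snd.snd.fst (fun w => (hm w).1)
      (fun w => (hm w).2.2.1)
    have h01 := hC.continuous_comp hp.fst hp.snd.snd.snd (fun w => (hm w).1)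
      (fun w => (hm w).2.2.2)
    have h10 := hC.continuous_comp hp.snd.fst hp.snd.snd.fst (fun w => (hm w).2.1)
      (fun w => (hm w).2.2.1)
    have h11 := hC.continuous_comp hp.snd.fst hp.snd.snd.snd (fun w => (hm w).2.1)
      (fun w => (hm w).2.2.2)
    exact ⟨hp.fst.sub h01, hp.snd.snd.fst.sub h10,
      (((continuous_const.sub hp.fst).sub hp.snd.snd.fst).add h00).sub
        (continuous_const.mul (((h11.sub h10).sub h01).add h00))⟩
  obtain ⟨h1, h2, h3⟩ := key hC
  obtain ⟨h1', h2', h3'⟩ := key hC'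
  exact (isClosed_eq h1 h1').inter ((isClosed_eq h2 h2').inter (isClosed_eq h3 h3'))

lemma ae_choiceProbsAgree {μ : Measure ((Fin k → ℝ) × (Fin k → ℝ))} [IsProbabilityMeasure μ]
    {θ θ' : GameParam k} {Q : Measure (((Fin k → ℝ) × (Fin k → ℝ)) × Bool × Bool)}
    (h : IsObservableLaw G μ θ Q) (h' : IsObservableLaw G μ θ' Q) (hη : ∀ x, 0 < G.η x)
    (hη_cont : Continuous G.η) (hF₁ : IsStrictContinuousCDF G.F₁)
    (hF₂ : IsStrictContinuousCDF G.F₂) (hlam : θ.lam ∈ Ioo (0 : ℝ) 1)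
    (hlam' : θ'.lam ∈ Ioo (0 : ℝ) 1) : ∀ᵐ w ∂μ, G.ChoiceProbsAgree θ θ' w := by
  filter_upwards [ae_eq_of_setLIntegral_eq_of_toReal (h.exists_density_10 hη hη_cont)
      (h'.exists_density_10 hη hη_cont),
    ae_eq_of_setLIntegral_eq_of_toReal (h.exists_density_01 hη hη_cont)
      (h'.exists_density_01 hη hη_cont),
    ae_eq_of_setLIntegral_eq_of_toReal (h.exists_density_00 hη hη_cont hF₁ hF₂ hlam)
      (h'.exists_density_00 hη hη_cont hF₁ hF₂ hlam')] with w h1 h2 h3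
  exact ⟨h1, h2, h3⟩

end GameSpec

/-! ### Identification at infinity -/

/-- Where the other choice probabilities agree, so do those of `D = (1, 1)`. -/
lemma choiceProb11_eq {C C' : ℝ → ℝ → ℝ} {lam lam' : ℝ} {p p' : ℝ × ℝ × ℝ × ℝ}
    (h10 : choiceProb10 C p = choiceProb10 C' p') (h01 : choiceProb01 C p = choiceProb01 C' p')
    (h00 : choiceProb00 C lam p = choiceProb00 C' lam' p') :
    C p.2.1 p.2.2.2 - lam * multProb C p = C' p'.2.1 p'.2.2.2 - lam' * multProb C' p' := by
  simp only [choiceProb10, choiceProb01, choiceProb00, multProb] at *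
  linarith

/-- The second player's treated index along the special regressor has this form, with `a` the
untreated index. For `r < 0` the shift `a + d / r` absorbs `d` into the assumed limit; for `r ≥ 0`
the `η` term is eventually bounded above. -/
lemma tendsto_add_comp_affine_atBot {F η : ℝ → ℝ} (hF : IsStrictContinuousCDF F)
    (hη : StrictMono η) {r d : ℝ}
    (h : 0 < r ∨ Tendsto (fun a => F (a + η (-(|r| * a)))) atBot (𝓝 0)) :
    Tendsto (fun a => a + η (r * a + d)) atBot atBot := by
  rcases lt_trichotomy r 0 with hr | rfl | hr
  · have h := hF.tendsto_zero_iff.1 (h.resolve_left hr.not_gt)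
    have hshift : Tendsto (fun a : ℝ => a + d / r) atBot atBot :=
      tendsto_atBot_add_const_right _ _ tendsto_id
    refine (tendsto_atBot_add_const_right _ (-(d / r)) (h.comp hshift)).congr fun a => ?_
    have : -(|r| * (a + d / r)) = r * a + d := by
      rw [abs_of_neg hr]
      have := hr.ne
      field_simp
    simp only [Function.comp_apply, this]
    ring
  · simpa using tendsto_atBot_add_const_right atBot (η d) tendsto_id
  · have hd : Tendsto (fun a : ℝ => r * a + d) atBot atBot :=
      tendsto_atBot_add_const_right _ _ (tendsto_id.const_mul_atBot hr)
    refine tendsto_atBot_mono' _ ?_ (tendsto_atBot_add_const_right _ (η 0) tendsto_id)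
    filter_upwards [hd.eventually_le_atBot 0] with a ha
    exact add_le_add_right (hη.monotone ha) _

/-- If the second player's probabilities vanish in the limit at the first of two
observationally equivalent structures, then the first player's are the same at both. -/
lemma eq_of_choiceProb_eq_of_tendsto {C C' : ℝ → ℝ → ℝ} (hC : IsCopula C) (hC' : IsCopula C')
    (hmono : ∀ v ∈ Ioo (0 : ℝ) 1, StrictMonoOn (fun u => C' u v) (Icc 0 1))
    {lam lam' : ℝ} (hlam : lam ∈ Ioo (0 : ℝ) 1) (hlam' : lam' ∈ Ioo (0 : ℝ) 1)
    {F : ℝ → ℝ} (hF : IsStrictContinuousCDF F) {a₁ b₁ a₁' b₁' r d : ℝ} {b₂ b₂' : ℝ → ℝ}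
    (ha₁ : a₁ ∈ Ioo (0 : ℝ) 1) (hb₁ : b₁ ∈ Ioo (0 : ℝ) 1) (ha₁' : a₁' ∈ Ioo (0 : ℝ) 1)
    (hb₁' : b₁' ∈ Ioo (0 : ℝ) 1) (hab : a₁ ≤ b₁) (hab' : a₁' ≤ b₁')
    (hb₂ : ∀ a, b₂ a ∈ Ioo (0 : ℝ) 1) (hb₂' : ∀ a, b₂' a ∈ Ioo (0 : ℝ) 1)
    (hab₂ : ∀ a, F a ≤ b₂ a) (hlim : Tendsto b₂ atBot (𝓝 0))
    (h10 : ∀ a, choiceProb10 C (a₁, b₁, F a, b₂ a) =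
      choiceProb10 C' (a₁', b₁', F (r * a + d), b₂' a))
    (h01 : ∀ a, choiceProb01 C (a₁, b₁, F a, b₂ a) =
      choiceProb01 C' (a₁', b₁', F (r * a + d), b₂' a))
    (h00 : ∀ a, choiceProb00 C lam (a₁, b₁, F a, b₂ a) =
      choiceProb00 C' lam' (a₁', b₁', F (r * a + d), b₂' a)) : a₁ = a₁' := by
  have h11 := fun a => choiceProb11_eq (h10 a) (h01 a) (h00 a)
  simp only [choiceProb10, choiceProb01, multProb] at h10 h01 h11
  have ia₁ := Ioo_subset_Icc_self ha₁
  have ib₁ := Ioo_subset_Icc_self hb₁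
  have ia₁' := Ioo_subset_Icc_self ha₁'
  have ib₁' := Ioo_subset_Icc_self hb₁'
  have ib₂ := fun a => Ioo_subset_Icc_self (hb₂ a)
  have ib₂' := fun a => Ioo_subset_Icc_self (hb₂' a)
  have iF := hF.mem_Icc
  have l01 : Tendsto (fun a => F (r * a + d) - C' b₁' (F (r * a + d))) atBot (𝓝 0) := by
    refine squeeze_zero (fun a => sub_nonneg.2 (hC'.le_right ib₁' (iF _))) (fun a => ?_)
      hF.tendsto_atBot
    rw [← h01]
    linarith [hC.nonneg ib₁ (iF a)]
  -- The sign of `r` is not assumed. For `r < 0` the probability of (0,1) at the second structure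
  -- would tend to `1 - b₁' > 0`; for `r = 0` it would be a positive constant.
  have lF' : Tendsto (fun a => F (r * a + d)) atBot (𝓝 0) := by
    rcases lt_trichotomy r 0 with hr | rfl | hr
    · exfalso
      have hd : Tendsto (fun a : ℝ => r * a + d) atBot atTop :=
        tendsto_atTop_add_const_right _ _ (tendsto_id.const_mul_atBot_of_neg hr)
      have hone := hF.tendsto_atTop.comp hd
      have hC'b : Tendsto (fun a => C' b₁' (F (r * a + d))) atBot (𝓝 b₁') := by
        have hdist : Tendsto (fun a => |F (r * a + d) - 1|) atBot (𝓝 0) := by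
          simpa using (hone.sub_const 1).abs
        rw [tendsto_iff_dist_tendsto_zero]
        refine squeeze_zero (fun _ => dist_nonneg) (fun a => ?_) hdist
        have := hC'.abs_sub_right_le ib₁' (iF (r * a + d)) (v' := 1) (by simp)
        rwa [hC'.one_right _ ib₁'] at this
      have := tendsto_nhds_unique l01 (hone.sub hC'b)
      linarith [hb₁'.2]
    · exfalso
      simp only [zero_mul, zero_add] at l01
      have h0 := tendsto_nhds_unique l01 tendsto_const_nhds
      have := hmono _ (hF.mem_Ioo d) ib₁' (by simp) hb₁'.2
      simp only [hC'.one_left _ (iF d)] at this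
      linarith
    · exact hF.tendsto_atBot.comp
        (tendsto_atBot_add_const_right _ _ (tendsto_id.const_mul_atBot hr))
  -- Compare the probabilities of (1,1): at the first structure it is at most `b₂ a`, at the second
  -- at least `C' a₁' (b₂' a) - F (r * a + d)`.
  have lC' : Tendsto (fun a => C' a₁' (b₂' a)) atBot (𝓝 0) := by
    refine squeeze_zero (fun a => hC'.nonneg ia₁' (ib₂' a)) (fun a => ?_)
      (by simpa using hlim.add lF')
    have hL := hC.two_increasing a₁ ia₁ b₁ ib₁ (F a) (iF a) (b₂ a) (ib₂ a) hab (hab₂ a)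
    have e1 := mul_nonneg hlam.1.le hL
    have e2 := hC.le_right ib₁ (ib₂ a)
    have e3 := hC'.le_right ia₁' (iF (r * a + d))
    have e4 := hC'.nonneg ib₁' (iF (r * a + d))
    have e5 := hC'.mono_left ia₁' ib₁' (ib₂' a) hab'
    have e6 := hlam'.1
    have e7 := hlam'.2
    have e8 := (iF (r * a + d)).1
    have := h11 a
    nlinarith [mul_nonneg e6.le e4, mul_nonneg e6.le (sub_nonneg.2 e3),
      mul_nonneg (sub_nonneg.2 e7.le) (sub_nonneg.2 e5), mul_nonneg (sub_nonneg.2 e7.le) e8]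
  have lC : Tendsto (fun a => C a₁ (b₂ a)) atBot (𝓝 0) :=
    squeeze_zero (fun a => hC.nonneg ia₁ (ib₂ a)) (fun a => hC.le_right ia₁ (ib₂ a)) hlim
  have e := tendsto_nhds_unique ((tendsto_const_nhds (x := a₁)).sub lC)
    (((tendsto_const_nhds (x := a₁')).sub lC').congr fun a => (h10 a).symm)
  simpa using e

/-! ### Identification of the copula parameter from two values of the second argument -/

/-- Each hypothesis says that `ψ u` takes the value `u'`, by injectivity of `C'` in its first
argument, and `ψ u` is injective. -/
lemma StrictlyMoreSJ.eq_of_eq_of_eq {C C' : ℝ → ℝ → ℝ} (h : StrictlyMoreSJ C C') {u u' v v' : ℝ}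
    (hu : u ∈ Ioo (0 : ℝ) 1) (hu' : u' ∈ Ioo (0 : ℝ) 1) (hv : v ∈ Ioo (0 : ℝ) 1)
    (hv' : v' ∈ Ioo (0 : ℝ) 1) (huv : C u v = C' u' v) (huv' : C u v' = C' u' v') : v = v' := by
  obtain ⟨-, hC', ψ, hψ, hψ_mono⟩ := h
  have key : ∀ x ∈ Ioo (0 : ℝ) 1, C u x = C' u' x → ψ u x = u' := fun x hx hux =>
    (hC' x hx).injOn (Ioo_subset_Icc_self (hψ u hu x hx).1) (Ioo_subset_Icc_self hu')
      (by simp only [(hψ u hu x hx).2, hux])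
  exact (hψ_mono u hu).injOn hv hv' (by simp only [key v hv huv, key v' hv' huv'])

/-! ### The special regressor and the rank conditions -/

/-- The covariate vector with coordinate `t` at `i₀` and the other coordinates `c`. -/
def insertCovariate {k : ℕ} (i₀ : Fin k) (c : {i : Fin k // i ≠ i₀} → ℝ) (t : ℝ) : Fin k → ℝ :=
  fun i => if h : i = i₀ then t else c ⟨i, h⟩

lemma continuous_insertCovariate {k : ℕ} (i₀ : Fin k) :
    Continuous fun x : ({i : Fin k // i ≠ i₀} → ℝ) × ℝ => insertCovariate i₀ x.1 x.2 := by
  refine continuous_pi fun i => ?_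
  by_cases h : i = i₀
  · simpa [insertCovariate, h] using continuous_snd
  · simp only [insertCovariate, h, dite_false]
    fun_prop

lemma insertCovariate_apply_self {k : ℕ} (i₀ : Fin k) (w : Fin k → ℝ) :
    insertCovariate i₀ (fun i => w i) (w i₀) = w := by
  ext i
  by_cases h : i = i₀
  · simp [insertCovariate, h]
  · simp [insertCovariate, h]

lemma dotProduct_insertCovariate {k : ℕ} (i₀ : Fin k) (c : {i : Fin k // i ≠ i₀} → ℝ) (t : ℝ)
    (γ : Fin k → ℝ) :
    dotProduct (insertCovariate i₀ c t) γ = γ i₀ * t + dotProduct (insertCovariate i₀ c 0) γ := by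
  have : insertCovariate i₀ c t = Pi.single i₀ t + insertCovariate i₀ c 0 := by
    ext i
    by_cases h : i = i₀
    · subst h
      simp [insertCovariate]
    · simp [insertCovariate, h]
  rw [this, add_dotProduct, single_dotProduct, mul_comm]

/-- Disintegrate `μ` over the other covariates. A positive conditional density turns conditionally
almost every `t` into Lebesgue almost every `t`, hence a dense set, and the section of `K` is
closed. -/
lemma LargeSupport.exists_forall_insertCovariate_mem {k : ℕ} {i₀ : Fin k}
    {μ : Measure ((Fin k → ℝ) × (Fin k → ℝ))} [IsProbabilityMeasure μ] (h : LargeSupport i₀ μ)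
    {V : Submodule ℝ (Fin k → ℝ)} (hV : V ≠ ⊤) {K : Set ((Fin k → ℝ) × (Fin k → ℝ))}
    (hK : IsClosed K) (hKμ : ∀ᵐ w ∂μ, w ∈ K) :
    ∃ w₁ ∉ V, ∃ c : {i : Fin k // i ≠ i₀} → ℝ, ∀ t, (w₁, insertCovariate i₀ c t) ∈ K := by
  have hX : Measurable (otherCovariates (k := k) i₀) := by
    unfold otherCovariates
    fun_prop
  have hY : Measurable (fun w : (Fin k → ℝ) × (Fin k → ℝ) => w.2 i₀) := by fun_prop
  set join : ((Fin k → ℝ) × ({i : Fin k // i ≠ i₀} → ℝ)) × ℝ → (Fin k → ℝ) × (Fin k → ℝ) :=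
    fun z => (z.1.1, insertCovariate i₀ z.1.2 z.2)
  have hjoin : Continuous join :=
    continuous_fst.fst.prodMk
      ((continuous_insertCovariate i₀).comp (continuous_fst.snd.prodMk continuous_snd))
  have hK' : IsClosed (join ⁻¹' K) := hK.preimage hjoin
  have h1 : ∀ᵐ z ∂(μ.map fun w => (otherCovariates i₀ w, w.2 i₀)), z ∈ join ⁻¹' K := by
    refine (ae_map_iff (hX.prodMk hY).aemeasurable hK'.measurableSet).2 ?_
    filter_upwards [hKμ] with w hw
    change (w.1, insertCovariate i₀ (fun i => w.2 i) (w.2 i₀)) ∈ K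
    rwa [insertCovariate_apply_self]
  rw [← compProd_map_condDistrib hY.aemeasurable] at h1
  have h2 := ae_of_ae_map hX.aemeasurable (Measure.ae_ae_of_ae_compProd h1)
  obtain ⟨w, ⟨⟨f, hf, hf_pos, hcond⟩, hwV⟩, hw⟩ :=
    ((frequently_ae_iff.2 (h V hV)).and_eventually h2).exists
  refine ⟨w.1, hwV, fun i => w.2 i, fun t => ?_⟩
  rw [hcond, ae_withDensity_iff hf] at hw
  have hdense : Dense {t : ℝ | (otherCovariates i₀ w, t) ∈ join ⁻¹' K} :=
    Measure.dense_of_ae (hw.mono fun t ht => ht (hf_pos t).ne')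
  have hclosed : IsClosed {t : ℝ | (otherCovariates i₀ w, t) ∈ join ⁻¹' K} :=
    hK'.preimage (Continuous.prodMk_right _)
  have := hclosed.closure_eq ▸ hdense t
  exact this

/-- The kernel consists of the covariates that cannot tell `γ` from `γ'`; it is the subspace to
which the rank conditions are applied. -/
lemma ker_dotProductBilin_sub_ne_top {k : ℕ} {γ γ' : Fin k → ℝ} (h : γ' ≠ γ) :
    LinearMap.ker (dotProductBilin ℝ ℝ (γ' - γ)) ≠ ⊤ := by
  intro htop
  have hself : γ' - γ ∈ LinearMap.ker (dotProductBilin ℝ ℝ (γ' - γ)) := htop ▸ Submodule.mem_top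
  exact h (sub_eq_zero.1 (dotProduct_self_eq_zero.1 hself))

namespace GameSpec

variable {k : ℕ} {G : GameSpec} {i₀ : Fin k} {θ θ' : GameParam k}

lemma index0_eq_of_choiceProbsAgree (hη_pos : ∀ x, 0 < G.η x) (hη_mono : StrictMono G.η)
    (hF₁ : IsStrictContinuousCDF G.F₁) (hF₂ : IsStrictContinuousCDF G.F₂)
    (hC : IsCopula (G.H θ.ρ)) (hC' : IsCopula (G.H θ'.ρ))
    (hmono : ∀ v ∈ Ioo (0 : ℝ) 1, StrictMonoOn (fun u => G.H θ'.ρ u v) (Icc 0 1))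
    (hlam : θ.lam ∈ Ioo (0 : ℝ) 1) (hlam' : θ'.lam ∈ Ioo (0 : ℝ) 1)
    (hcoef : CoefCondition G i₀ θ) {w₁ : Fin k → ℝ} {c : {i : Fin k // i ≠ i₀} → ℝ}
    (h : ∀ t, G.ChoiceProbsAgree θ θ' (w₁, insertCovariate i₀ c t)) :
    θ.index0 w₁ = θ'.index0 w₁ := by
  obtain ⟨hγ, hcoef⟩ := hcoef
  have hlt : ∀ (θ : GameParam k) w, θ.index0 w < G.index1 θ w := fun θ w =>
    lt_add_of_pos_right _ (hη_pos _)
  set δ := dotProduct (insertCovariate i₀ c 0) θ.γ₀ with hδ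
  -- The value of the special regressor at which the second player's untreated index at `θ` equals
  -- `a`; every other index is then affine in `a`.
  set s : ℝ → ℝ := fun a => (a - δ) / θ.γ₀ i₀ with hs
  have hdot : ∀ (γ : Fin k → ℝ) a, dotProduct (insertCovariate i₀ c (s a)) γ =
      γ i₀ / θ.γ₀ i₀ * a + (dotProduct (insertCovariate i₀ c 0) γ - γ i₀ / θ.γ₀ i₀ * δ) := by
    intro γ a
    rw [dotProduct_insertCovariate, hs]
    field_simp
    ring
  have hdot₀ : ∀ a, dotProduct (insertCovariate i₀ c (s a)) θ.γ₀ = a := fun a => by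
    rw [hdot, div_self hγ, ← hδ]
    ring
  have hlim : Tendsto (fun a => G.F₂ (G.index1 θ (insertCovariate i₀ c (s a)))) atBot (𝓝 0) := by
    rw [hF₂.tendsto_zero_iff]
    have hr : 0 < θ.γ₁ i₀ / θ.γ₀ i₀ ∨
        Tendsto (fun a => G.F₂ (a + G.η (-(|θ.γ₁ i₀ / θ.γ₀ i₀| * a)))) atBot (𝓝 0) :=
      hcoef.imp_left fun hpos => by
        rcases mul_pos_iff.1 hpos with hp | hp
        · exact div_pos hp.2 hp.1
        · exact div_pos_of_neg_of_neg hp.2 hp.1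
    refine (tendsto_add_comp_affine_atBot hF₂ hη_mono
      (d := dotProduct (insertCovariate i₀ c 0) θ.γ₁ - θ.γ₁ i₀ / θ.γ₀ i₀ * δ) hr).congr fun a => ?_
    rw [GameSpec.index1, hdot₀, hdot θ.γ₁]
  have hF2 : ∀ a, G.F₂ (θ.index0 (insertCovariate i₀ c (s a))) = G.F₂ a := fun a => by
    rw [GameParam.index0, hdot₀]
  have hF2' : ∀ a, G.F₂ (θ'.index0 (insertCovariate i₀ c (s a))) =
      G.F₂ (θ'.γ₀ i₀ / θ.γ₀ i₀ * a +
        (dotProduct (insertCovariate i₀ c 0) θ'.γ₀ - θ'.γ₀ i₀ / θ.γ₀ i₀ * δ)) := fun a => by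
    rw [GameParam.index0, hdot]
  have hagree := fun a => h (s a)
  simp only [ChoiceProbsAgree, probVec, hF2, hF2'] at hagree
  refine hF₁.strictMono.injective (eq_of_choiceProb_eq_of_tendsto hC hC' hmono hlam hlam' hF₂
    (hF₁.mem_Ioo _) (hF₁.mem_Ioo _) (hF₁.mem_Ioo _) (hF₁.mem_Ioo _)
    (hF₁.strictMono (hlt θ w₁)).le (hF₁.strictMono (hlt θ' w₁)).le
    (fun a => hF₂.mem_Ioo _) (fun a => hF₂.mem_Ioo _) (fun a => ?_) hlim
    (fun a => (hagree a).1) (fun a => (hagree a).2.1) (fun a => (hagree a).2.2))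
  rw [← hF2]
  exact (hF₂.strictMono (hlt θ _)).le

lemma copula_index1_eq_of_choiceProbsAgree (hγ₀ : θ'.γ₀ = θ.γ₀)
    {w : (Fin k → ℝ) × (Fin k → ℝ)} (h : G.ChoiceProbsAgree θ θ' w) :
    G.H θ.ρ (G.F₁ (G.index1 θ w.1)) (G.F₂ (θ.index0 w.2)) =
      G.H θ'.ρ (G.F₁ (G.index1 θ' w.1)) (G.F₂ (θ.index0 w.2)) := by
  have := h.2.1
  simp only [choiceProb01, probVec, GameParam.index0, hγ₀] at this ⊢
  linarith

end GameSpec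

/-- A point of the support of the law of `𝐩` with multiple equilibria of positive probability
has such a covariate value nearby, in every set of full measure. -/
lemma exists_multProb_probVec_pos {k : ℕ} {G : GameSpec} {θ : GameParam k}
    {μ : Measure ((Fin k → ℝ) × (Fin k → ℝ))} (hη : Continuous G.η)
    (hF₁ : IsStrictContinuousCDF G.F₁) (hF₂ : IsStrictContinuousCDF G.F₂)
    (hC : IsCopula (G.H θ.ρ))
    (h : ∃ p ∈ (μ.map (G.probVec θ)).support, 0 < multProb (G.H θ.ρ) p)
    {K : Set ((Fin k → ℝ) × (Fin k → ℝ))} (hK : ∀ᵐ w ∂μ, w ∈ K) :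
    ∃ w ∈ K, 0 < multProb (G.H θ.ρ) (G.probVec θ w) := by
  obtain ⟨p, hp, hpos⟩ := h
  set B : Set (ℝ × ℝ × ℝ × ℝ) := Icc 0 1 ×ˢ Icc 0 1 ×ˢ Icc 0 1 ×ˢ Icc 0 1 with hB
  have hBc : IsClosed B :=
    isClosed_Icc.prod (isClosed_Icc.prod (isClosed_Icc.prod isClosed_Icc))
  have hcont := G.continuous_probVec hη hF₁.continuous hF₂.continuous θ
  have hmem : ∀ w, G.probVec θ w ∈ B := G.probVec_mem hF₁ hF₂ θ
  -- The support point `p` need not be a value of `G.probVec θ`, and the copula is continuous only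
  -- on the unit square.
  have hpB : p ∈ B := by
    refine Measure.support_subset_of_isClosed hBc ?_ hp
    exact (ae_map_iff hcont.measurable.aemeasurable hBc.measurableSet).2
      (Eventually.of_forall hmem)
  have hmult : ContinuousOn (multProb (G.H θ.ρ)) B := by
    have hc := hC.continuousOn
    have h11 : ContinuousOn (fun p : ℝ × ℝ × ℝ × ℝ => G.H θ.ρ p.2.1 p.2.2.2) B :=
      hc.comp (f := fun p : ℝ × ℝ × ℝ × ℝ => (p.2.1, p.2.2.2)) (by fun_prop)
        fun p hp => ⟨hp.2.1, hp.2.2.2⟩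
    have h10 : ContinuousOn (fun p : ℝ × ℝ × ℝ × ℝ => G.H θ.ρ p.2.1 p.2.2.1) B :=
      hc.comp (f := fun p : ℝ × ℝ × ℝ × ℝ => (p.2.1, p.2.2.1)) (by fun_prop)
        fun p hp => ⟨hp.2.1, hp.2.2.1⟩
    have h01 : ContinuousOn (fun p : ℝ × ℝ × ℝ × ℝ => G.H θ.ρ p.1 p.2.2.2) B :=
      hc.comp (f := fun p : ℝ × ℝ × ℝ × ℝ => (p.1, p.2.2.2)) (by fun_prop)
        fun p hp => ⟨hp.1, hp.2.2.2⟩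
    have h00 : ContinuousOn (fun p : ℝ × ℝ × ℝ × ℝ => G.H θ.ρ p.1 p.2.2.1) B :=
      hc.comp (f := fun p : ℝ × ℝ × ℝ × ℝ => (p.1, p.2.2.1)) (by fun_prop)
        fun p hp => ⟨hp.1, hp.2.2.1⟩
    exact ((h11.sub h10).sub h01).add h00
  have hnhds : ∀ᶠ q in 𝓝 p, q ∈ B → 0 < multProb (G.H θ.ρ) q :=
    eventually_nhdsWithin_iff.1 ((hmult p hpB).eventually_const_lt hpos)
  obtain ⟨U, hU, hUo, hpU⟩ := eventually_nhds_iff.1 hnhds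
  have hUμ : μ (G.probVec θ ⁻¹' U) ≠ 0 := by
    rw [← Measure.map_apply hcont.measurable hUo.measurableSet]
    exact ((Measure.mem_support_iff_forall p).1 hp U (hUo.mem_nhds hpU)).ne'
  obtain ⟨w, hwU, hwK⟩ := ((frequently_ae_iff.2 hUμ).and_eventually hK).exists
  exact ⟨w, hwK, hU _ hwU (hmem w)⟩

/-! ### The identification theorem -/

theorem mainTheorem5 {k : ℕ} (G : GameSpec) (i₀ : Fin k)
    (Θ : Set (GameParam k))
    (hΘ : ∀ θ ∈ Θ, θ.ρ ∈ Set.Ioo G.ρmin G.ρmax ∧ θ.lam ∈ Set.Ioo (0 : ℝ) 1)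
    (μ : MeasureTheory.Measure ((Fin k → ℝ) × (Fin k → ℝ)))
    [MeasureTheory.IsProbabilityMeasure μ]
    (θ : GameParam k) (hθ : θ ∈ Θ)
    -- regularity of the interaction function, the marginals and the copula
    (hη_pos : ∀ x, 0 < G.η x) (hη_mono : StrictMono G.η) (hη_cont : Continuous G.η)
    (hF₁ : IsStrictContinuousCDF G.F₁) (hF₂ : IsStrictContinuousCDF G.F₂)
    (hH : ∀ ρ ∈ Set.Ioo G.ρmin G.ρmax,
      IsCopula (G.H ρ) ∧ HasCopulaDensity (G.H ρ) ∧ IsTwiceDifferentiable (G.H ρ))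
    -- the copula is ordered in stochastic increasingness
    (hSJ : ∀ ρ ∈ Set.Ioo G.ρmin G.ρmax, ∀ ρ' ∈ Set.Ioo G.ρmin G.ρmax,
      ρ < ρ' → StrictlyMoreSJ (G.H ρ) (G.H ρ'))
    -- large support and rank conditions
    (hsupp : LargeSupport i₀ μ) (hrank : VariationRank θ.γ₀ μ)
    (hcoef : CoefCondition G i₀ θ)
    -- the parameter set
    (hopen : ∀ w₁ ∈ (μ.map Prod.fst).support, w₁ ≠ 0 →
      IsOpen {z : ℝ × ℝ | ∃ θ' ∈ Θ, z = (G.index1 θ' w₁, θ'.ρ)} ∧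
      IsSimplyConnected {z : ℝ × ℝ | ∃ θ' ∈ Θ, z = (G.index1 θ' w₁, θ'.ρ)})
    (hγ₀ : θ.γ₀ ≠ 0) (hγ₁ : θ.γ₁ ≠ 0)
    -- multiple equilibria have positive probability somewhere
    (hmul : ∃ p ∈ (μ.map (G.probVec θ)).support, 0 < multProb (G.H θ.ρ) p) :
    IsGloballyIdentified G μ Θ θ := by
  intro θ' hθ' Q hQ hQ'
  obtain ⟨hρ, hlam⟩ := hΘ θ hθ
  obtain ⟨hρ', hlam'⟩ := hΘ θ' hθ'
  have hC := (hH _ hρ).1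
  have hC' := (hH _ hρ').1
  have hmono : ∀ ρ ∈ Ioo G.ρmin G.ρmax, ∀ v ∈ Ioo (0 : ℝ) 1,
      StrictMonoOn (fun u => G.H ρ u v) (Icc 0 1) := fun ρ hρ => by
    -- Strict monotonicity in the first argument is part of the ordering, so any larger parameter
    -- value serves as comparison.
    obtain ⟨σ, hσ, hσ'⟩ := exists_between hρ.2
    exact (hSJ ρ hρ σ ⟨hρ.1.trans hσ, hσ'⟩ hσ).1
  set K := {w | G.ChoiceProbsAgree θ θ' w}
  have hK : IsClosed K := G.isClosed_choiceProbsAgree hη_cont hF₁ hF₂ hC hC'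
  have hKμ : ∀ᵐ w ∂μ, w ∈ K :=
    G.ae_choiceProbsAgree hQ hQ' hη_pos hη_cont hF₁ hF₂ hlam hlam'
  have hKsupp : μ.support ⊆ K := Measure.support_subset_of_isClosed hK hKμ
  have hγ₀_eq : θ'.γ₀ = θ.γ₀ := by
    by_contra hne
    obtain ⟨w₁, hw₁, c, hc⟩ :=
      hsupp.exists_forall_insertCovariate_mem (ker_dotProductBilin_sub_ne_top hne) hK hKμ
    have := G.index0_eq_of_choiceProbsAgree hη_pos hη_mono hF₁ hF₂ hC hC' (hmono _ hρ') hlam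
      hlam' hcoef hc
    refine hw₁ ?_
    simp only [GameParam.index0] at this
    simp [dotProduct_comm _ w₁, this]
  have hinj : ∀ {w₂ w₂'}, dotProduct w₂ θ.γ₀ ≠ dotProduct w₂' θ.γ₀ →
      G.F₂ (θ.index0 w₂) ≠ G.F₂ (θ.index0 w₂') := fun hne => hF₂.strictMono.injective.ne hne
  have hρ_eq : θ'.ρ = θ.ρ := by
    obtain ⟨w₁, w₂, w₂', hw, hw', hne⟩ := hrank.1
    have e := G.copula_index1_eq_of_choiceProbsAgree hγ₀_eq (hKsupp hw)
    have e' := G.copula_index1_eq_of_choiceProbsAgree hγ₀_eq (hKsupp hw')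
    by_contra hρne
    refine hinj hne ?_
    rcases lt_or_gt_of_ne hρne with hlt | hlt
    · exact (hSJ _ hρ' _ hρ hlt).eq_of_eq_of_eq (hF₁.mem_Ioo _) (hF₁.mem_Ioo _) (hF₂.mem_Ioo _)
        (hF₂.mem_Ioo _) e.symm e'.symm
    · exact (hSJ _ hρ _ hρ' hlt).eq_of_eq_of_eq (hF₁.mem_Ioo _) (hF₁.mem_Ioo _) (hF₂.mem_Ioo _)
        (hF₂.mem_Ioo _) e e'
  have hγ₁_eq : θ'.γ₁ = θ.γ₁ := by
    by_contra hne
    obtain ⟨w₁, ⟨w₂, w₂', hw, -, -⟩, hw₁⟩ :=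
      nonempty_of_measure_ne_zero (hrank.2 _ (ker_dotProductBilin_sub_ne_top hne))
    have e := G.copula_index1_eq_of_choiceProbsAgree hγ₀_eq (hKsupp hw)
    rw [hρ_eq] at e
    have e1 := hF₁.strictMono.injective
      ((hmono _ hρ _ (hF₂.mem_Ioo _)).injOn (hF₁.mem_Icc _) (hF₁.mem_Icc _) e)
    simp only [GameSpec.index1, hγ₀_eq] at e1
    have e2 := hη_mono.injective (add_left_cancel e1)
    refine hw₁ ?_
    simp [dotProduct_comm _ w₁, e2]
  have hlam_eq : θ'.lam = θ.lam := by
    obtain ⟨w, hw, hpos⟩ := exists_multProb_probVec_pos hη_cont hF₁ hF₂ hC hmul hKμ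
    have hp : G.probVec θ' w = G.probVec θ w := by
      simp only [GameSpec.probVec, GameParam.index0, GameSpec.index1, hγ₀_eq, hγ₁_eq]
    have h00 := hw.2.2
    rw [hp, hρ_eq] at h00
    simp only [choiceProb00] at h00
    -- All else being equal, the two probabilities of (0,0) differ by (λ' − λ) times the positive
    -- multiplicity probability.
    have := mul_right_cancel₀ hpos.ne' (sub_right_injective h00)
    linarith
  cases θ
  cases θ'
  simp_all
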